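/- Let $X,Y$ be Banach spaces (real or complex). All subspaces and operators are linear; a closed operator $A$ from $X$ to $Y$ has a domain $\mathrm{dom}(A)\subseteq X$ that may be a proper subspace, and its graph $G_A=\{(x,Ax):x\in\mathrm{dom}(A)\}$ is closed in $X\times Y$, which carries the norm $\max\{\|x\|,\|y\|\}$. A closed operator is called lower semi-Fredholm if its image is closed in $Y$ and its kernel is finite-dimensional. Below $\mathbb N'\supseteq\mathbb N''\supseteq\mathbb N'''$ denote infinite subsets of $\mathbb N$. Let $(M_n)_{n\in\mathbb N'}$, $(P_n)_{n\in\mathbb N'}$ be sequences of closed subspaces of a Banach space $Z$. (a) For $\lambda\ge 0$, $(M_n)_{\mathbb N'}$ is lower uniformly $\lambda$-adjusted with $(P_n)_{\mathbb N'}$ if for every $\eta>0$, every $\mathbb N''\subseteq\mathbb N'$ and all unit vectors $x_n\in M_n$ $(n\in\mathbb N'')$ there are $\mathbb N'''\subseteq\mathbb N''$, vectors $y_n\in P_n$ $(n\in\mathbb N''')$ and $z\in Z$ with $\varlimsup_{n\in\mathbb N'''}\|x_n-y_n-z\|\le\lambda+\eta$. Let $\lambda_{\mathbb N'}[M_n,P_n]$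 be the infimum of all such $\lambda\ge 0$. (b) $\mathcal{SS}\lambda_{\mathbb N'}[M_n,P_n]$ is the infimum of all $\lambda\ge0$ such that for every $\mathbb N''\subseteq\mathbb N'$ and all closed infinite-dimensional subspaces $K_n\subseteq M_n$ $(n\in\mathbb N'')$ there are $\mathbb N'''\subseteq\mathbb N''$ and closed infinite-dimensional subspaces $L_n\subseteq K_n$ $(n\in\mathbb N''')$ with $\lambda_{\mathbb N'''}[L_n,P_n]\le\lambda$. (c) $\mathcal{FSS}\lambda_{\mathbb N'}[M_n,P_n]$ is the infimum of all $\lambda\ge0$ such that for every $\mathbb N''\subseteq\mathbb N'$ and all finite-dimensional subspaces $K_n\subseteq M_n$ $(n\in\mathbb N'')$ with $\lim_{n\in\mathbb N''}\dim K_n=\infty$ there are $\mathbb N'''\subseteq\mathbb N''$ and subspaces $L_n\subseteq K_n$ $(n\in\mathbb N''')$ with $\lim_{n\in\mathbb N'''}\dim L_n=\infty$ and $\lambda_{\mathbb N'''}[L_n,P_n]\le\lambda$. For closed operators $A_n$ $(n\in\mathbb N')$ and $A$ from $X$ to $Y$ put $\mathcal{SS}\lambda_{\mathbb N'}[A_n,A]:=\mathcal{SS}\lambda_{\mathbb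 N'}[G_{A_n},G_A]$ and $\mathcal{FSS}\lambda_{\mathbb N'}[A_n,A]:=\mathcal{FSS}\lambda_{\mathbb N'}[G_{A_n},G_A]$, both in $X\times Y$. Theorem. Let $A$ be a lower semi-Fredholm closed operator from $X$ to $Y$. There is $\varepsilon>0$, depending only on $A$ (and on $X$, $Y$), such that for every infinite $\mathbb N'\subseteq\mathbb N$ and every sequence $(A_n)_{n\in\mathbb N'}$ of closed operators from $X$ to $Y$: 1. if $\mathcal{FSS}\lambda_{\mathbb N'}[A_n,A]<\varepsilon$, then $A_n$ is lower semi-Fredholm for all large enough $n\in\mathbb N'$, and $\varlimsup_{n\in\mathbb N'}\dim\operatorname{Ker}(A_n)<\infty$; 2. if $\mathcal{SS}\lambda_{\mathbb N'}[A_n,A]<\varepsilon$, then $A_n$ is lower semi-Fredholm for all large enough $n\in\mathbb N'$. -/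

import Mathlib

open Filter Topology
open scoped ENNReal

namespace UniformAdjustment

/-- The filter of "large enough `n ∈ S`", for a set `S` of natural numbers. -/
def along (S : Set ℕ) : Filter ℕ := atTop ⊓ 𝓟 S

section Subspaces

variable {𝕜 : Type*} [RCLike 𝕜] {E : Type*} [NormedAddCommGroup E] [NormedSpace 𝕜 E]

/-- The sequence of subspaces `(M n)`, `n ∈ S`, is lower uniformly `l`-adjusted with `(P n)`,
`n ∈ S`: for every `η > 0` and every unit sequence `x n ∈ M n` given along an infinite `S₁ ⊆ S`,
there are an infinite `S₂ ⊆ S₁`, vectors `y n ∈ P n` for `n ∈ S₂`, and `z : E` such that the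
upper limit of `‖x n - y n - z‖` along `S₂` is at most `l + η`. The upper limit is taken in
`[0, ∞]`, so that it is meaningful for unbounded sequences too. -/
def LowerAdjusted (S : Set ℕ) (M P : ℕ → Submodule 𝕜 E) (l : ℝ) : Prop :=
  ∀ η : ℝ, 0 < η → ∀ S₁ : Set ℕ, S₁ ⊆ S → S₁.Infinite →
    ∀ x : ℕ → E, (∀ n ∈ S₁, x n ∈ M n ∧ ‖x n‖ = 1) →
      ∃ S₂ : Set ℕ, S₂ ⊆ S₁ ∧ S₂.Infinite ∧
        ∃ y : ℕ → E, (∀ n ∈ S₂, y n ∈ P n) ∧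
          ∃ z : E, limsup (fun n => ‖x n - y n - z‖ₑ) (along S₂) ≤ ENNReal.ofReal (l + η)

/-- The uniform adjustment number `λ_S[M n, P n]`. The set is bounded below by `0` and
contains `1` (take `y = 0`, `z = 0`). -/
noncomputable def adjustment (S : Set ℕ) (M P : ℕ → Submodule 𝕜 E) : ℝ :=
  sInf {l : ℝ | 0 ≤ l ∧ LowerAdjusted S M P l}

/-- `(M n)`, `n ∈ S`, is lower strictly singular uniformly `l`-adjusted with `(P n)`, `n ∈ S`. -/
def LowerSSAdjusted (S : Set ℕ) (M P : ℕ → Submodule 𝕜 E) (l : ℝ) : Prop :=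
  ∀ S₁ : Set ℕ, S₁ ⊆ S → S₁.Infinite →
    ∀ K : ℕ → Submodule 𝕜 E,
      (∀ n ∈ S₁, K n ≤ M n ∧ IsClosed (K n : Set E) ∧ ¬ FiniteDimensional 𝕜 (K n)) →
      ∃ S₂ : Set ℕ, S₂ ⊆ S₁ ∧ S₂.Infinite ∧
        ∃ L : ℕ → Submodule 𝕜 E,
          (∀ n ∈ S₂, L n ≤ K n ∧ IsClosed (L n : Set E) ∧ ¬ FiniteDimensional 𝕜 (L n)) ∧
          adjustment S₂ L P ≤ l

/-- The strictly singular uniform adjustment number `SSλ_S[M n, P n]`. -/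
noncomputable def ssAdjustment (S : Set ℕ) (M P : ℕ → Submodule 𝕜 E) : ℝ :=
  sInf {l : ℝ | 0 ≤ l ∧ LowerSSAdjusted S M P l}

/-- `(M n)`, `n ∈ S`, is lower finitely strictly singular uniformly `l`-adjusted with `(P n)`,
`n ∈ S`. (The subspaces `L n ≤ K n` are finite-dimensional because the `K n` are.) -/
def LowerFSSAdjusted (S : Set ℕ) (M P : ℕ → Submodule 𝕜 E) (l : ℝ) : Prop :=
  ∀ S₁ : Set ℕ, S₁ ⊆ S → S₁.Infinite →
    ∀ K : ℕ → Submodule 𝕜 E,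
      (∀ n ∈ S₁, K n ≤ M n ∧ FiniteDimensional 𝕜 (K n)) →
      Tendsto (fun n => Module.finrank 𝕜 (K n)) (along S₁) atTop →
      ∃ S₂ : Set ℕ, S₂ ⊆ S₁ ∧ S₂.Infinite ∧
        ∃ L : ℕ → Submodule 𝕜 E,
          (∀ n ∈ S₂, L n ≤ K n) ∧
          Tendsto (fun n => Module.finrank 𝕜 (L n)) (along S₂) atTop ∧
          adjustment S₂ L P ≤ l

/-- The finitely strictly singular uniform adjustment number `FSSλ_S[M n, P n]`. -/
noncomputable def fssAdjustment (S : Set ℕ) (M P : ℕ → Submodule 𝕜 E) : ℝ :=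
  sInf {l : ℝ | 0 ≤ l ∧ LowerFSSAdjusted S M P l}

end Subspaces

section Operators

variable {𝕜 : Type*} [RCLike 𝕜] {X Y : Type*}
  [NormedAddCommGroup X] [NormedSpace 𝕜 X] [NormedAddCommGroup Y] [NormedSpace 𝕜 Y]

/-- `SSλ_S[A n, B n]` for partially defined operators: the number of their graphs in `X × Y`
(with the maximum norm). -/
noncomputable def opSSAdjustment (S : Set ℕ) (A B : ℕ → X →ₗ.[𝕜] Y) : ℝ :=
  ssAdjustment S (fun n => (A n).graph) (fun n => (B n).graph)

/-- `FSSλ_S[A n, B n]` for partially defined operators: the number of their graphs in `X × Y`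
(with the maximum norm). -/
noncomputable def opFSSAdjustment (S : Set ℕ) (A B : ℕ → X →ₗ.[𝕜] Y) : ℝ :=
  fssAdjustment S (fun n => (A n).graph) (fun n => (B n).graph)

/-- The kernel `{x ∈ dom A | A x = 0}`, as a subspace of `dom A`. -/
def kernel (A : X →ₗ.[𝕜] Y) : Submodule 𝕜 A.domain := LinearMap.ker A.toFun

/-- The image `{A x | x ∈ dom A}`. -/
def image (A : X →ₗ.[𝕜] Y) : Submodule 𝕜 Y := LinearMap.range A.toFun

/-- The dimension of the kernel, `⊤` if it is not finite. -/
noncomputable def kernelDim (A : X →ₗ.[𝕜] Y) : ℕ∞ :=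
  Cardinal.toENat (Module.rank 𝕜 (kernel A))

/-- A closed operator with closed image and finite-dimensional kernel. -/
def IsLowerSemiFredholm (A : X →ₗ.[𝕜] Y) : Prop :=
  A.IsClosed ∧ IsClosed (image A : Set Y) ∧ FiniteDimensional 𝕜 (kernel A)

end Operators

end UniformAdjustment

/-! When `B n` fails to be lower semi-Fredholm, or has a large kernel, its graph contains a large
subspace on which the second coordinate is tiny relative to the norm. This is Kato's theorem for the
projection of the graph to `Y`; a large kernel gives it at once
(`exists_graph_subspace_finrank_eq`). If this happens for infinitely many `n`, the SS or FSS
hypothesis passes to subspaces `L n` of still unbounded dimension whose adjustment number with the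
graph of `A` is below `ε`.

`exists_le_adjustment` excludes this. Unbounded dimension yields `1`-separated unit vectors `x n` in
`L n`. If they are close to `y n + z` with `y n` in the graph of `A`, the differences of the `y n`
have small second coordinates. Since `A` has closed image, these differences are small corrections
away from `Ker A`. As `Ker A` is finite-dimensional, compactness puts two of the `x n` closer than
`1`. The resulting `ε` depends only on the lifting constant of `A`. -/

namespace UniformAdjustment

/-! ### Bounded operators that are small on infinite-dimensional subspaces. -/

section Normed

variable {𝕜 : Type*} [RCLike 𝕜] {E : Type*} [NormedAddCommGroup E] [NormedSpace 𝕜 E]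

/-- Fewer functionals than the dimension of `L` have a common zero on the unit sphere of `L`. -/
theorem exists_unit_forall_eq_zero (L : Submodule 𝕜 E) (s : Finset (E →L[𝕜] 𝕜))
    (h : ((s.card + 1 : ℕ) : Cardinal) ≤ Module.rank 𝕜 L) :
    ∃ w ∈ L, ‖w‖ = 1 ∧ ∀ f ∈ s, f w = 0 := by
  let F : L →ₗ[𝕜] (s → 𝕜) := LinearMap.pi fun f => (f : E →L[𝕜] 𝕜).toLinearMap ∘ₗ L.subtype
  have hF : ¬ Function.Injective F := by
    intro hinj
    have h1 := LinearMap.lift_rank_le_of_injective F hinj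
    rw [rank_fun'] at h1
    simp only [Fintype.card_coe, Cardinal.lift_natCast, Cardinal.lift_le_nat_iff] at h1
    have h2 := h.trans h1
    norm_cast at h2
    omega
  rw [← LinearMap.ker_eq_bot, Submodule.eq_bot_iff] at hF
  push Not at hF
  obtain ⟨x, hx, hx0⟩ := hF
  have hxE : (x : E) ≠ 0 := by simpa using hx0
  refine ⟨((‖(x : E)‖⁻¹ : ℝ) : 𝕜) • (x : E), L.smul_mem _ x.2, ?_, fun f hf => ?_⟩
  · rw [norm_smul, RCLike.norm_ofReal, abs_inv, abs_norm, inv_mul_cancel₀ (norm_ne_zero_iff.2 hxE)]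
  · have : f x = 0 := congrFun hx ⟨f, hf⟩
    simp [this]

/-- A bounded operator on a Banach space that is bounded below on a closed subspace of finite
codimension has finite-dimensional kernel and closed range. -/
theorem finiteDimensional_ker_and_isClosed_range {G F V : Type*}
    [NormedAddCommGroup G] [NormedSpace 𝕜 G] [CompleteSpace G]
    [NormedAddCommGroup F] [NormedSpace 𝕜 F]
    [NormedAddCommGroup V] [NormedSpace 𝕜 V] [FiniteDimensional 𝕜 V]
    (T : G →L[𝕜] F) (f : G →L[𝕜] V) {c : ℝ} (hc : 0 < c)
    (h : ∀ v, f v = 0 → c * ‖v‖ ≤ ‖T v‖) :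
    FiniteDimensional 𝕜 T.ker ∧ IsClosed (T.range : Set F) := by
  constructor
  · refine Module.Finite.of_injective (f.toLinearMap ∘ₗ T.ker.subtype) ?_
    rw [← LinearMap.ker_eq_bot, Submodule.eq_bot_iff]
    intro v hv
    have h1 := h v hv
    have hT : T v = 0 := v.2
    rw [hT, norm_zero] at h1
    have : ‖(v : G)‖ ≤ 0 := by
      by_contra hn
      exact absurd h1 (not_le.2 (mul_pos hc (not_le.1 hn)))
    simpa using this
  -- The range is the image of `f.ker`, closed because `T` is bounded below there, plus the image of
  -- a finite-dimensional complement.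
  · obtain ⟨W, hW⟩ := f.ker.exists_isCompl
    have : FiniteDimensional 𝕜 (G ⧸ f.ker) :=
      (f.toLinearMap.quotKerEquivRange).symm.finiteDimensional
    have : FiniteDimensional 𝕜 W :=
      (Submodule.quotientEquivOfIsCompl _ _ hW).finiteDimensional
    have hcl : IsClosed ((f.ker.map T.toLinearMap : Submodule 𝕜 F) : Set F) := by
      have hcomp : CompleteSpace f.ker := f.isClosed_ker.completeSpace_coe
      have ha : AntilipschitzWith (Real.toNNReal c⁻¹) (T.comp f.ker.subtypeL) := by
        refine ContinuousLinearMap.antilipschitz_of_bound _ fun v => ?_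
        have h1 := h v v.2
        rw [Real.coe_toNNReal _ (inv_nonneg.2 hc.le), inv_mul_eq_div, le_div_iff₀' hc]
        exact h1
      have := ha.isClosed_range (T.comp f.ker.subtypeL).uniformContinuous
      convert this
      ext y
      simp
    have hr : T.range = f.ker.map T.toLinearMap ⊔ W.map T.toLinearMap := by
      rw [← Submodule.map_sup, hW.sup_eq_top, Submodule.map_top]
    rw [hr]
    exact Submodule.isClosed_sup_finiteDimensional _ _ hcl

/-- Kato: a bounded operator that does not have finite-dimensional kernel and closed range is
arbitrarily small on some closed infinite-dimensional subspace. -/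
theorem exists_infinite_dimensional_norm_le {G F : Type*}
    [NormedAddCommGroup G] [NormedSpace 𝕜 G] [CompleteSpace G]
    [NormedAddCommGroup F] [NormedSpace 𝕜 F]
    (T : G →L[𝕜] F) (hT : ¬ (FiniteDimensional 𝕜 T.ker ∧ IsClosed (T.range : Set F)))
    {δ : ℝ} (hδ : 0 < δ) :
    ∃ K : Submodule 𝕜 G, IsClosed (K : Set G) ∧ ¬ FiniteDimensional 𝕜 K ∧
      ∀ v ∈ K, ‖T v‖ ≤ δ * ‖v‖ := by
  classical
  have hsmall : ∀ (s : Finset (G →L[𝕜] 𝕜)) (c : ℝ), 0 < c →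
      ∃ v : G, ‖v‖ = 1 ∧ ‖T v‖ ≤ c ∧ ∀ f ∈ s, f v = 0 := by
    intro s c hc
    by_contra! hno
    refine hT (finiteDimensional_ker_and_isClosed_range T
      (ContinuousLinearMap.pi fun f : s => (f : G →L[𝕜] 𝕜)) hc fun v hv => ?_)
    rcases eq_or_ne v 0 with rfl | hv0
    · simp
    by_contra! hlt
    have hn : 0 < ‖v‖ := norm_pos_iff.2 hv0
    obtain ⟨f, hf, hne⟩ := hno (((‖v‖⁻¹ : ℝ) : 𝕜) • v)
      (by rw [norm_smul, RCLike.norm_ofReal, abs_inv, abs_norm, inv_mul_cancel₀ hn.ne'])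
      (by
        rw [map_smul, norm_smul, RCLike.norm_ofReal, abs_inv, abs_norm, inv_mul_eq_div,
          div_le_iff₀ hn]
        exact hlt.le)
    apply hne
    have : f v = 0 := congrFun hv ⟨f, hf⟩
    simp [this]
  -- The natural number in each triple increases strictly, hence dominates the index; this turns the
  -- bound on `T` into decay along the sequence. Each functional norms its own vector and kills all
  -- later ones.
  obtain ⟨p, hp, hr⟩ := exists_seq_of_forall_finset_exists
    (fun p : ℕ × G × (G →L[𝕜] 𝕜) =>
      ‖p.2.1‖ = 1 ∧ ‖p.2.2‖ = 1 ∧ p.2.2 p.2.1 = 1 ∧ ‖T p.2.1‖ ≤ δ * (1 / 4) ^ (p.1 + 1))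
    (fun p q => p.1 < q.1 ∧ p.2.2 q.2.1 = 0) (by
      intro s _
      obtain ⟨v, hv, hTv, hf⟩ := hsmall (s.image fun p => p.2.2)
        (δ * (1 / 4) ^ (s.sup (fun p => p.1) + 1 + 1)) (by positivity)
      obtain ⟨g, hg, hgv⟩ := exists_dual_vector 𝕜 v (by rw [hv]; exact one_ne_zero)
      refine ⟨(s.sup (fun p => p.1) + 1, v, g), ⟨hv, hg, by simp [hgv, hv], hTv⟩,
        fun q hq => ⟨Nat.lt_succ_of_le (Finset.le_sup (f := fun p => p.1) hq), ?_⟩⟩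
      exact hf _ (Finset.mem_image_of_mem (fun p : ℕ × G × (G →L[𝕜] 𝕜) => p.2.2) hq))
  have hmono : StrictMono fun n => (p n).1 := fun m n h => (hr m n h).1
  set v : ℕ → G := fun n => (p n).2.1 with hvdef
  set f : ℕ → G →L[𝕜] 𝕜 := fun n => (p n).2.2 with hfdef
  have hv1 : ∀ n, ‖v n‖ = 1 := fun n => (hp n).1
  have hf1 : ∀ n, ‖f n‖ = 1 := fun n => (hp n).2.1
  have hfv : ∀ n, f n (v n) = 1 := fun n => (hp n).2.2.1
  have hfv0 : ∀ m n, m < n → f m (v n) = 0 := fun m n h => (hr m n h).2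
  have hTv : ∀ n, ‖T (v n)‖ ≤ δ * (1 / 4) ^ (n + 1) := fun n =>
    (hp n).2.2.2.trans (mul_le_mul_of_nonneg_left
      (pow_le_pow_of_le_one (by norm_num) (by norm_num)
        (Nat.succ_le_succ (hmono.le_apply (x := n)))) hδ.le)
  -- Triangularity gives `‖a n‖ ≤ ‖x‖ + ∑ i < n, ‖a i‖`, so the coefficients grow at most like `2 ^
  -- n`. The factors `(1 / 4) ^ (n + 1)` absorb this growth.
  have hsum : ∀ (N : ℕ) (a : ℕ → 𝕜), ∀ n < N,
      ‖a n‖ ≤ 2 ^ n * ‖∑ i ∈ Finset.range N, a i • v i‖ := by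
    intro N a n
    induction n using Nat.strong_induction_on with
    | _ n ih =>
      intro hn
      set x := ∑ i ∈ Finset.range N, a i • v i
      have h1 : f n x = ∑ i ∈ Finset.range n, a i * f n (v i) + a n := by
        simp only [x, map_sum, map_smul, smul_eq_mul]
        rw [← Finset.sum_subset (Finset.range_subset_range.2 (Nat.succ_le_of_lt hn)),
          Finset.sum_range_succ, hfv, mul_one]
        intro i _ hi
        rw [hfv0 n i (by simpa using hi), mul_zero]
      have h2 : ‖a n‖ ≤ ‖f n x‖ + ∑ i ∈ Finset.range n, ‖a i‖ := by
        have h3 : a n = f n x - ∑ i ∈ Finset.range n, a i * f n (v i) := by rw [h1]; ring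
        calc ‖a n‖ ≤ ‖f n x‖ + ‖∑ i ∈ Finset.range n, a i * f n (v i)‖ := by
              rw [h3]; exact norm_sub_le _ _
          _ ≤ _ := by
            gcongr
            refine norm_sum_le_of_le _ fun i _ => ?_
            rw [norm_mul]
            refine mul_le_of_le_one_right (norm_nonneg _) ?_
            simpa [hf1, hv1] using (f n).le_opNorm (v i)
      have h4 : ‖f n x‖ ≤ ‖x‖ := by simpa [hf1] using (f n).le_opNorm x
      have h5 : ∑ i ∈ Finset.range n, ‖a i‖ ≤ ∑ i ∈ Finset.range n, 2 ^ i * ‖x‖ :=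
        Finset.sum_le_sum fun i hi =>
          ih i (Finset.mem_range.1 hi) ((Finset.mem_range.1 hi).trans hn)
      rw [← Finset.sum_mul, geom_sum_eq (by norm_num)] at h5
      norm_num at h5
      linarith
  have hli : LinearIndependent 𝕜 v := by
    rw [linearIndependent_iff']
    intro s a h0 i hi
    have hb := hsum (s.sup id + 1) (fun j => if j ∈ s then a j else 0) i
      (Nat.lt_succ_of_le (Finset.le_sup (f := id) hi))
    have : ∑ j ∈ Finset.range (s.sup id + 1), (if j ∈ s then a j else 0) • v j = 0 := by
      have hsub : s ⊆ Finset.range (s.sup id + 1) := fun j hj =>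
        Finset.mem_range.2 (Nat.lt_succ_of_le (Finset.le_sup (f := id) hj))
      rw [← h0, ← Finset.sum_subset hsub fun j _ hj => by simp [hj]]
      exact Finset.sum_congr rfl fun j hj => by simp [hj]
    rw [this] at hb
    simpa [hi] using hb
  refine ⟨(Submodule.span 𝕜 (Set.range v)).topologicalClosure,
    Submodule.isClosed_topologicalClosure _, fun hfin => ?_, fun x hx => ?_⟩
  · have : FiniteDimensional 𝕜 (Submodule.span 𝕜 (Set.range v)) :=
      Submodule.finiteDimensional_of_le (Submodule.le_topologicalClosure _)
    have hli' := linearIndependent_span hli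
    exact not_finite_iff_infinite.2 (inferInstance : Infinite ℕ) hli'.finite
  · have hcl : IsClosed {x : G | ‖T x‖ ≤ δ * ‖x‖} :=
      isClosed_le (by fun_prop) (by fun_prop)
    refine closure_minimal ?_ hcl hx
    intro x hx
    obtain ⟨c, rfl⟩ := (Finsupp.mem_span_range_iff_exists_finsupp).1 hx
    set N := c.support.sup id + 1
    have hx' : (c.sum fun i a => a • v i) = ∑ i ∈ Finset.range N, c i • v i := by
      refine Finsupp.sum_of_support_subset _ (fun j hj => ?_) _ (by simp)
      exact Finset.mem_range.2 (Nat.lt_succ_of_le (Finset.le_sup (f := id) hj))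
    have hb := hsum N c
    rw [← hx'] at hb
    set x := c.sum fun i a => a • v i
    change ‖T x‖ ≤ δ * ‖x‖
    calc ‖T x‖ ≤ ∑ i ∈ Finset.range N, δ * ‖x‖ * (1 / 2) ^ (i + 1) := by
          rw [hx', map_sum]
          refine norm_sum_le_of_le _ fun i hi => ?_
          rw [map_smul, norm_smul, ← hx']
          have h2 : (2 : ℝ) ^ i * (1 / 4) ^ (i + 1) ≤ (1 / 2) ^ (i + 1) := by
            rw [pow_succ, pow_succ, ← mul_assoc, ← mul_pow]
            norm_num
          calc ‖c i‖ * ‖T (v i)‖ ≤ (2 ^ i * ‖x‖) * (δ * (1 / 4) ^ (i + 1)) :=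
                mul_le_mul (hb i (Finset.mem_range.1 hi)) (hTv i) (norm_nonneg _) (by positivity)
            _ = δ * ‖x‖ * (2 ^ i * (1 / 4) ^ (i + 1)) := by ring
            _ ≤ _ := by gcongr
      _ ≤ δ * ‖x‖ * 1 := by
          rw [← Finset.mul_sum]
          gcongr
          have hg : ∀ N : ℕ, ∑ i ∈ Finset.range N, (1 / 2 : ℝ) ^ (i + 1) = 1 - (1 / 2) ^ N := by
            intro N
            induction N with
            | zero => simp
            | succ k ih => rw [Finset.sum_range_succ, ih]; ring
          rw [hg]
          have : (0 : ℝ) ≤ (1 / 2) ^ N := by positivity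
          linarith
      _ = δ * ‖x‖ := mul_one _

end Normed

/-! ### Limits along infinite sets of indices. -/

theorem frequently_along {S : Set ℕ} {p : ℕ → Prop} :
    (∃ᶠ n in along S, p n) ↔ ∃ᶠ n in atTop, n ∈ S ∧ p n := by
  rw [along, frequently_inf_principal]

theorem eventually_along {S : Set ℕ} {p : ℕ → Prop} :
    (∀ᶠ n in along S, p n) ↔ ∀ᶠ n in atTop, n ∈ S → p n := by
  rw [along, eventually_inf_principal]

theorem along_neBot {S : Set ℕ} (hS : S.Infinite) : (along S).NeBot := by
  rw [along, ← frequently_mem_iff_neBot]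
  exact Nat.frequently_atTop_iff_infinite.2 hS

theorem along_range {φ : ℕ → ℕ} (hφ : StrictMono φ) : along (Set.range φ) = map φ atTop := by
  rw [along, ← map_comap, comap_embedding_atTop (fun _ _ => hφ.le_iff_le)
    fun c => ⟨c, hφ.le_apply⟩]

/-! ### Adjustment numbers and separated sequences. -/

section Subspaces

variable {𝕜 : Type*} [RCLike 𝕜] {E : Type*} [NormedAddCommGroup E] [NormedSpace 𝕜 E]

/-- The set defining `adjustment` is therefore nonempty, so its `sInf` is a true infimum and not the
default value `0`. -/
theorem lowerAdjusted_one (S : Set ℕ) (M P : ℕ → Submodule 𝕜 E) : LowerAdjusted S M P 1 := by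
  intro η hη S₁ _ hS₁ x hx
  refine ⟨S₁, subset_rfl, hS₁, 0, fun n _ => (P n).zero_mem, 0, ?_⟩
  refine limsup_le_of_le (by isBoundedDefault) (eventually_along.2 (Eventually.of_forall ?_))
  intro n hn
  simp only [Pi.zero_apply, sub_zero]
  rw [← ofReal_norm, (hx n hn).2]
  exact ENNReal.ofReal_le_ofReal (by linarith)

theorem adjustment_le_one (S : Set ℕ) (M P : ℕ → Submodule 𝕜 E) : adjustment S M P ≤ 1 :=
  csInf_le ⟨0, fun _ h => h.1⟩ ⟨zero_le_one, lowerAdjusted_one S M P⟩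

theorem exists_lowerAdjusted_of_adjustment_lt {S : Set ℕ} {M P : ℕ → Submodule 𝕜 E} {c : ℝ}
    (h : adjustment S M P < c) : ∃ l, l < c ∧ LowerAdjusted S M P l := by
  obtain ⟨l, hl, hlc⟩ := exists_lt_of_csInf_lt
    (s := {l : ℝ | 0 ≤ l ∧ LowerAdjusted S M P l}) ⟨1, zero_le_one, lowerAdjusted_one S M P⟩ h
  exact ⟨l, hlc, hl.2⟩

theorem exists_lowerSSAdjusted_of_ssAdjustment_lt {S : Set ℕ} {M P : ℕ → Submodule 𝕜 E} {c : ℝ}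
    (h : ssAdjustment S M P < c) : ∃ l, l < c ∧ LowerSSAdjusted S M P l := by
  obtain ⟨l, hl, hlc⟩ := exists_lt_of_csInf_lt
    (s := {l : ℝ | 0 ≤ l ∧ LowerSSAdjusted S M P l}) ⟨1, zero_le_one, fun S₁ _ hS₁ K hK =>
      ⟨S₁, subset_rfl, hS₁, K, fun n hn => ⟨le_rfl, (hK n hn).2⟩, adjustment_le_one _ _ _⟩⟩ h
  exact ⟨l, hlc, hl.2⟩

theorem exists_lowerFSSAdjusted_of_fssAdjustment_lt {S : Set ℕ} {M P : ℕ → Submodule 𝕜 E} {c : ℝ}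
    (h : fssAdjustment S M P < c) : ∃ l, l < c ∧ LowerFSSAdjusted S M P l := by
  obtain ⟨l, hl, hlc⟩ := exists_lt_of_csInf_lt
    (s := {l : ℝ | 0 ≤ l ∧ LowerFSSAdjusted S M P l}) ⟨1, zero_le_one, fun S₁ _ hS₁ K _ hK =>
      ⟨S₁, subset_rfl, hS₁, K, fun _ _ => le_rfl, hK, adjustment_le_one _ _ _⟩⟩ h
  exact ⟨l, hlc, hl.2⟩

/-- Subspaces of unbounded dimension contain a `1`-separated sequence of unit vectors. -/
theorem exists_separated_seq {S : Set ℕ} {L : ℕ → Submodule 𝕜 E}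
    (h : ∀ N : ℕ, ∃ᶠ n in along S, (N : Cardinal) ≤ Module.rank 𝕜 (L n)) :
    ∃ (φ : ℕ → ℕ) (w : ℕ → E), StrictMono φ ∧
      (∀ k, φ k ∈ S ∧ w k ∈ L (φ k) ∧ ‖w k‖ = 1) ∧ ∀ i j, i < j → 1 ≤ ‖w i - w j‖ := by
  classical
  obtain ⟨p, hp, hr⟩ := exists_seq_of_forall_finset_exists
    (fun p : ℕ × E => p.1 ∈ S ∧ p.2 ∈ L p.1 ∧ ‖p.2‖ = 1)
    (fun p q => p.1 < q.1 ∧ 1 ≤ ‖p.2 - q.2‖) (by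
      intro s hs
      -- A new vector killed by the norming functionals of all earlier ones is at distance at least
      -- `1` from each of them.
      choose g hg using fun x : E => exists_dual_vector'' 𝕜 x
      obtain ⟨n, hn, hnS, hrank⟩ := (frequently_atTop.1 (frequently_along.1 (h (s.card + 1))))
        (s.sup (fun p => p.1) + 1)
      have hcard : (s.image fun p => g p.2).card ≤ s.card := Finset.card_image_le
      obtain ⟨w, hwL, hw, h0⟩ := exists_unit_forall_eq_zero (L n) (s.image fun p => g p.2)
        (le_trans (by exact_mod_cast Nat.succ_le_succ hcard) hrank)
      refine ⟨(n, w), ⟨hnS, hwL, hw⟩, fun q hq =>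
        ⟨(Nat.lt_succ_of_le (Finset.le_sup (f := fun p => p.1) hq)).trans_le hn, ?_⟩⟩
      have h1 : g q.2 w = 0 := h0 _ (Finset.mem_image_of_mem (fun p : ℕ × E => g p.2) hq)
      have h2 : ‖g q.2 (q.2 - w)‖ = 1 := by
        rw [map_sub, h1, (hg q.2).2, (hs q hq).2.2]
        simp
      rw [← h2]
      exact (g q.2).le_of_opNorm_le (hg q.2).1 _ |>.trans (one_mul _).le)
  exact ⟨fun n => (p n).1, fun n => (p n).2, fun m n h => (hr m n h).1, hp,
    fun i j hij => (hr i j hij).2⟩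

end Subspaces

/-! ### Graphs of closed operators and the lower bound for the adjustment number. -/

section Operators

variable {𝕜 : Type*} [RCLike 𝕜] {X Y : Type*}
  [NormedAddCommGroup X] [NormedSpace 𝕜 X] [NormedAddCommGroup Y] [NormedSpace 𝕜 Y]

/-- The projection of the graph of `B` to the target space. -/
noncomputable def graphSnd (B : X →ₗ.[𝕜] Y) : B.graph →L[𝕜] Y :=
  (ContinuousLinearMap.snd 𝕜 X Y).comp B.graph.subtypeL

theorem range_graphSnd (B : X →ₗ.[𝕜] Y) : (graphSnd B).range = image B := by
  ext y
  constructor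
  · rintro ⟨⟨p, hp⟩, rfl⟩
    obtain ⟨x, _, hx⟩ := (LinearPMap.mem_graph_iff B).1 hp
    exact ⟨x, hx⟩
  · rintro ⟨x, rfl⟩
    exact ⟨⟨_, B.mem_graph x⟩, rfl⟩

/-- The kernel of `B`, as a subspace of its domain or of its graph. -/
noncomputable def kernelEquiv (B : X →ₗ.[𝕜] Y) : kernel B ≃ₗ[𝕜] (graphSnd B).ker :=
  LinearEquiv.ofBijective
    ((((LinearMap.inl 𝕜 X Y ∘ₗ B.domain.subtype) ∘ₗ (kernel B).subtype).codRestrict B.graph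
      (fun x => (LinearPMap.mem_graph_iff B).2 ⟨x, rfl, x.2⟩)).codRestrict (graphSnd B).ker
        (fun _ => rfl))
    ⟨fun x y h => by
      have h1 := congrArg (fun p : (graphSnd B).ker => ((p : B.graph) : X × Y).1) h
      exact Subtype.ext (Subtype.ext h1),
    fun ⟨⟨p, hp⟩, hp0⟩ => by
      obtain ⟨x, hx1, hx2⟩ := (LinearPMap.mem_graph_iff B).1 hp
      refine ⟨⟨x, hx2.trans hp0⟩, ?_⟩
      refine Subtype.ext (Subtype.ext (Prod.ext hx1 ?_))
      exact Eq.symm hp0⟩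

/-- Replaces a possibly unbounded operator by the bounded projection of its graph, to which Kato's
theorem and the open mapping theorem apply. -/
theorem isLowerSemiFredholm_iff {B : X →ₗ.[𝕜] Y} (hB : B.IsClosed) :
    IsLowerSemiFredholm B ↔
      FiniteDimensional 𝕜 (graphSnd B).ker ∧ IsClosed ((graphSnd B).range : Set Y) := by
  rw [IsLowerSemiFredholm, range_graphSnd, and_comm (a := FiniteDimensional 𝕜 _)]
  have : FiniteDimensional 𝕜 (kernel B) ↔ FiniteDimensional 𝕜 (graphSnd B).ker :=
    Module.Finite.equiv_iff (kernelEquiv B)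
  simp only [hB, true_and, this]

variable [CompleteSpace X] [CompleteSpace Y]

theorem exists_graph_subspace_of_not_isLowerSemiFredholm {B : X →ₗ.[𝕜] Y} (hB : B.IsClosed)
    (hn : ¬ IsLowerSemiFredholm B) {δ : ℝ} (hδ : 0 < δ) :
    ∃ K : Submodule 𝕜 (X × Y), (K ≤ B.graph ∧ IsClosed (K : Set (X × Y)) ∧
      ¬ FiniteDimensional 𝕜 K) ∧ ∀ p ∈ K, ‖p.2‖ ≤ δ * ‖p‖ := by
  have hB' : IsClosed (B.graph : Set (X × Y)) := hB
  have : CompleteSpace B.graph := hB'.completeSpace_coe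
  rw [isLowerSemiFredholm_iff hB] at hn
  obtain ⟨K, hK, hKinf, hle⟩ := exists_infinite_dimensional_norm_le (graphSnd B) hn hδ
  refine ⟨K.map B.graph.subtype, ⟨Submodule.map_subtype_le _ _, ?_, fun h => hKinf ?_⟩, ?_⟩
  · exact hB'.isClosedEmbedding_subtypeVal.isClosedMap _ hK
  · exact (Submodule.equivMapOfInjective B.graph.subtype B.graph.injective_subtype
      K).symm.finiteDimensional
  · rintro _ ⟨p, hp, rfl⟩
    exact hle p hp

/-- An operator with closed image has preimages of controlled norm. -/
theorem exists_graph_preimage_norm_le {A : X →ₗ.[𝕜] Y} (hA : A.IsClosed)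
    (hr : IsClosed (image A : Set Y)) :
    ∃ C : ℝ, 0 < C ∧ ∀ p ∈ A.graph, ∃ q ∈ A.graph, q.2 = p.2 ∧ ‖q‖ ≤ C * ‖p.2‖ := by
  have hA' : IsClosed (A.graph : Set (X × Y)) := hA
  have : CompleteSpace A.graph := hA'.completeSpace_coe
  rw [← range_graphSnd] at hr
  have : CompleteSpace (graphSnd A).range := hr.completeSpace_coe
  obtain ⟨C, hC, h⟩ := (graphSnd A).rangeRestrict.exists_preimage_norm_le
    (LinearMap.surjective_rangeRestrict _)
  refine ⟨C, hC, fun p hp => ?_⟩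
  obtain ⟨q, hq, hqC⟩ := h ⟨p.2, ⟨p, hp⟩, rfl⟩
  exact ⟨q, q.2, congrArg Subtype.val hq, hqC⟩

/-- Subspaces of unbounded dimension on which the second projection tends to zero are not
uniformly adjusted with the graph of a lower semi-Fredholm operator. -/
theorem exists_le_adjustment {A : X →ₗ.[𝕜] Y} (hA : IsLowerSemiFredholm A) :
    ∃ ε : ℝ, 0 < ε ∧ ∀ (S : Set ℕ) (L : ℕ → Submodule 𝕜 (X × Y)),
      (∀ N : ℕ, ∃ᶠ n in along S, (N : Cardinal) ≤ Module.rank 𝕜 (L n)) →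
      (∀ δ : ℝ, 0 < δ → ∀ᶠ n in along S, ∀ p ∈ L n, ‖p.2‖ ≤ δ * ‖p‖) →
      ε ≤ adjustment S L (fun _ => A.graph) := by
  obtain ⟨C, hC, hpre⟩ := exists_graph_preimage_norm_le hA.1 hA.2.1
  -- The final estimate of `‖x m - x n‖` costs `4 * ε + ε + 12 * C * ε`, which must stay below `1`.
  set ε : ℝ := 1 / (12 * C + 6) with hε
  have hε0 : 0 < ε := by positivity
  have hεC : ε * (12 * C + 6) = 1 := by rw [hε]; field_simp
  refine ⟨ε, hε0, fun S L hrank hsmall => ?_⟩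
  by_contra! hlt
  obtain ⟨l, hl, hadj⟩ := exists_lowerAdjusted_of_adjustment_lt hlt
  obtain ⟨φ, w, hφ, hw, hsep⟩ := exists_separated_seq hrank
  have hx : ∀ n ∈ Set.range φ, Function.extend φ w 0 n ∈ L n ∧ ‖Function.extend φ w 0 n‖ = 1 := by
    rintro _ ⟨k, rfl⟩
    rw [hφ.injective.extend_apply]
    exact (hw k).2
  obtain ⟨S₂, hS₂, hS₂inf, y, hy, z, hz⟩ := hadj ε hε0 (Set.range φ)
    (by rintro _ ⟨k, rfl⟩; exact (hw k).1) (Set.infinite_range_of_injective hφ.injective) _ hx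
  set x : ℕ → X × Y := Function.extend φ w 0
  have hxsep : ∀ m ∈ S₂, ∀ n ∈ S₂, m ≠ n → 1 ≤ ‖x m - x n‖ := by
    intro m hm n hn hmn
    obtain ⟨i, rfl⟩ := hS₂ hm
    obtain ⟨j, rfl⟩ := hS₂ hn
    simp only [x, hφ.injective.extend_apply]
    rcases lt_trichotomy i j with h | rfl | h
    · exact hsep i j h
    · exact absurd rfl hmn
    · rw [norm_sub_rev]
      exact hsep j i h
  have hev : ∀ᶠ n in along S₂, ‖x n - y n - z‖ < 2 * ε := by
    have h1 : limsup (fun n => ‖x n - y n - z‖ₑ) (along S₂) < ENNReal.ofReal (2 * ε) :=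
      hz.trans_lt ((ENNReal.ofReal_lt_ofReal_iff (by positivity)).2 (by linarith))
    filter_upwards [eventually_lt_of_limsup_lt h1] with n hn
    rw [← ofReal_norm] at hn
    exact (ENNReal.ofReal_lt_ofReal_iff (by positivity)).1 hn
  obtain ⟨N₁, hN₁⟩ := eventually_atTop.1 (eventually_along.1 hev)
  obtain ⟨N₂, hN₂⟩ := eventually_atTop.1 (eventually_along.1 (hsmall ε hε0))
  set S₃ : Set ℕ := S₂ \ Set.Iio (max N₁ N₂)
  have hS₃ : S₃.Infinite := hS₂inf.sdiff (Set.finite_Iio _)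
  have hnear : ∀ n ∈ S₃, ‖x n - y n - z‖ < 2 * ε := fun n hn =>
    hN₁ n ((le_max_left _ _).trans (not_lt.1 hn.2)) hn.1
  have hxsnd : ∀ n ∈ S₃, ‖(x n).2‖ ≤ ε := fun n hn => by
    have h1 := hx n (hS₂ hn.1)
    obtain ⟨k, hk⟩ := hS₂ hn.1
    have h2 := hN₂ n ((le_max_right _ _).trans (not_lt.1 hn.2)) (hk ▸ (hw k).1) _ h1.1
    rwa [h1.2, mul_one] at h2
  obtain ⟨m₀, hm₀⟩ := hS₃.nonempty
  -- Taking differences eliminates `z`.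
  have hdiff : ∀ m ∈ S₃, ∀ n ∈ S₃, ‖(x m - x n) - (y m - y n)‖ ≤ 4 * ε := by
    intro m hm n hn
    have : (x m - x n) - (y m - y n) = (x m - y m - z) - (x n - y n - z) := by abel
    rw [this]
    have := norm_sub_le (x m - y m - z) (x n - y n - z)
    linarith [hnear m hm, hnear n hn]
  have hysnd : ∀ m ∈ S₃, ∀ n ∈ S₃, ‖(y m - y n).2‖ ≤ 6 * ε := by
    intro m hm n hn
    have h1 : ‖((x m - x n) - (y m - y n)).2‖ ≤ 4 * ε := (norm_snd_le _).trans (hdiff m hm n hn)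
    have h2 : (y m - y n).2 = ((x m).2 - (x n).2) - ((x m - x n) - (y m - y n)).2 := by
      simp only [Prod.snd_sub]; abel
    rw [h2]
    have h3 := norm_sub_le ((x m).2 - (x n).2) ((x m - x n) - (y m - y n)).2
    have h4 := norm_sub_le (x m).2 (x n).2
    linarith [hxsnd m hm, hxsnd n hn]
  -- `q n` is a small lift of the second coordinate of `y n - y m₀`; subtracting it leaves a bounded
  -- vector `k n` of the kernel.
  have hq : ∀ n, ∃ q ∈ A.graph, n ∈ S₃ → q.2 = (y n - y m₀).2 ∧ ‖q‖ ≤ 6 * C * ε := by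
    intro n
    by_cases hn : n ∈ S₃
    · obtain ⟨q, hqA, hq2, hqC⟩ := hpre _ (A.graph.sub_mem (hy n hn.1) (hy m₀ hm₀.1))
      refine ⟨q, hqA, fun _ => ⟨hq2, hqC.trans ?_⟩⟩
      have := mul_le_mul_of_nonneg_left (hysnd n hn m₀ hm₀) hC.le
      linarith
    · exact ⟨0, A.graph.zero_mem, fun h => absurd h hn⟩
  choose q hqA hq using hq
  have : FiniteDimensional 𝕜 (graphSnd A).ker := ((isLowerSemiFredholm_iff hA.1).1 hA).1
  have : ProperSpace (graphSnd A).ker := FiniteDimensional.proper_rclike 𝕜 (graphSnd A).ker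
  have hk : ∀ n, ∃ k : (graphSnd A).ker, n ∈ S₃ → ((k : A.graph) : X × Y) = y n - y m₀ - q n := by
    intro n
    by_cases hn : n ∈ S₃
    · refine ⟨⟨⟨y n - y m₀ - q n,
        A.graph.sub_mem (A.graph.sub_mem (hy n hn.1) (hy m₀ hm₀.1)) (hqA n)⟩, ?_⟩, fun _ => rfl⟩
      rw [LinearMap.mem_ker]
      change (y n - y m₀ - q n).2 = 0
      rw [Prod.snd_sub, (hq n hn).1, sub_self]
    · exact ⟨0, fun h => absurd h hn⟩
  choose k hk using hk
  have hkb : ∀ n ∈ S₃, ‖k n‖ ≤ 2 + 4 * ε + 6 * C * ε := by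
    intro n hn
    have h0 : ‖k n‖ = ‖y n - y m₀ - q n‖ := by rw [← hk n hn]; rfl
    have h1 : y n - y m₀ = (x n - x m₀) - ((x n - x m₀) - (y n - y m₀)) := by abel
    have h2 := norm_sub_le (x n - x m₀) ((x n - x m₀) - (y n - y m₀))
    rw [← h1] at h2
    have h3 := norm_sub_le (x n) (x m₀)
    have h4 := norm_sub_le (y n - y m₀) (q n)
    rw [h0]
    linarith [hdiff n hn m₀ hm₀, (hq n hn).2, (hx n (hS₂ hn.1)).2, (hx m₀ (hS₂ hm₀.1)).2]
  -- Bolzano–Weierstrass in the finite-dimensional kernel.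
  obtain ⟨m, hm, n, hn, hmn, hkmn⟩ : ∃ m ∈ S₃, ∃ n ∈ S₃, m ≠ n ∧ dist (k m) (k n) < ε := by
    have he : ∀ i, (hS₃.natEmbedding _ i : ℕ) ∈ S₃ := fun i => (hS₃.natEmbedding _ i).2
    obtain ⟨a, -, ψ, hψ, hlim⟩ := tendsto_subseq_of_bounded
      (Metric.isBounded_closedBall (x := (0 : (graphSnd A).ker)))
      (x := fun i => k (hS₃.natEmbedding _ i)) (fun i => (dist_zero_right (k _)).trans_le (hkb _ (he i)))
    obtain ⟨N, hN⟩ := Metric.cauchySeq_iff.1 hlim.cauchySeq ε hε0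
    refine ⟨_, he (ψ N), _, he (ψ (N + 1)), fun h => ?_, hN N le_rfl (N + 1) N.le_succ⟩
    exact absurd (hψ.injective ((hS₃.natEmbedding _).injective (Subtype.ext h))) N.succ_ne_self.symm
  have hfin : ‖x m - x n‖ < 1 := by
    have h1 : ‖(y m - y m₀ - q m) - (y n - y m₀ - q n)‖ < ε := by
      rw [← hk m hm, ← hk n hn, ← dist_eq_norm]
      exact hkmn
    have h2 : x m - x n = ((x m - x n) - (y m - y n)) +
        (((y m - y m₀ - q m) - (y n - y m₀ - q n)) + (q m - q n)) := by abel
    have h3 := norm_sub_le (q m) (q n)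
    have h4 := norm_add₃_le (a := (x m - x n) - (y m - y n))
      (b := (y m - y m₀ - q m) - (y n - y m₀ - q n)) (c := q m - q n)
    rw [add_assoc, ← h2] at h4
    linarith [hdiff m hm n hn, (hq m hm).2, (hq n hn).2]
  exact absurd (hxsep m hm.1 n hn.1 hmn) (not_le.2 hfin)

end Operators

/-! ### Transfer to sequences of operators. -/

section Operators

variable {𝕜 : Type*} [RCLike 𝕜] {X Y : Type*}
  [NormedAddCommGroup X] [NormedSpace 𝕜 X] [NormedAddCommGroup Y] [NormedSpace 𝕜 Y]

theorem exists_le_finrank_eq {E : Type*} [AddCommGroup E] [Module 𝕜 E] {M : Submodule 𝕜 E} {k : ℕ}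
    (h : (k : Cardinal) ≤ Module.rank 𝕜 M) :
    ∃ K ≤ M, FiniteDimensional 𝕜 K ∧ Module.finrank 𝕜 K = k := by
  obtain ⟨v, hv⟩ := Module.le_rank_iff.1 h
  have hv' : LinearIndependent 𝕜 (M.subtype ∘ v) := hv.map' _ M.ker_subtype
  refine ⟨Submodule.span 𝕜 (Set.range (M.subtype ∘ v)), ?_, ?_, ?_⟩
  · rw [Submodule.span_le]
    rintro _ ⟨i, rfl⟩
    exact (v i).2
  · exact FiniteDimensional.span_of_finite 𝕜 (Set.finite_range _)
  · rw [finrank_span_eq_card hv', Fintype.card_fin]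

theorem exists_graph_subspace_of_le_kernelDim {B : X →ₗ.[𝕜] Y} {k : ℕ}
    (h : (k : ℕ∞) ≤ kernelDim B) :
    ∃ K ≤ B.graph, FiniteDimensional 𝕜 K ∧ Module.finrank 𝕜 K = k ∧ ∀ p ∈ K, p.2 = 0 := by
  have hr : (k : Cardinal) ≤ Module.rank 𝕜 (kernel B) := Cardinal.natCast_le_toENat.1 h
  have hr' : (k : Cardinal) ≤ Module.rank 𝕜 ((graphSnd B).ker.map B.graph.subtype) := by
    have e : kernel B ≃ₗ[𝕜] (graphSnd B).ker.map B.graph.subtype :=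
      (kernelEquiv B).trans (Submodule.equivMapOfInjective _ B.graph.injective_subtype _)
    have h1 := LinearMap.lift_rank_le_of_injective e.toLinearMap e.injective
    have h2 : (k : Cardinal) ≤ Cardinal.lift (Module.rank 𝕜 (kernel B)) := by simpa using hr
    simpa using h2.trans h1
  obtain ⟨K, hK, hfd, hfr⟩ := exists_le_finrank_eq hr'
  refine ⟨K, hK.trans (Submodule.map_subtype_le _ _), hfd, hfr, fun p hp => ?_⟩
  obtain ⟨q, hq, rfl⟩ := hK hp
  exact hq

variable [CompleteSpace X] [CompleteSpace Y]

/-- Treats both ways in which the FSS conclusion can fail at once: the subspace is cut out of Kato's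
infinite-dimensional one, or out of the kernel, where the second coordinate vanishes. -/
theorem exists_graph_subspace_finrank_eq {B : X →ₗ.[𝕜] Y} (hB : B.IsClosed) {k : ℕ}
    (h : ¬ IsLowerSemiFredholm B ∨ (k : ℕ∞) ≤ kernelDim B) {δ : ℝ} (hδ : 0 < δ) :
    ∃ K ≤ B.graph, FiniteDimensional 𝕜 K ∧ Module.finrank 𝕜 K = k ∧
      ∀ p ∈ K, ‖p.2‖ ≤ δ * ‖p‖ := by
  rcases h with h | h
  · obtain ⟨M, ⟨hM, -, hinf⟩, hle⟩ := exists_graph_subspace_of_not_isLowerSemiFredholm hB h hδ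
    obtain ⟨K, hK, hfd, hfr⟩ := exists_le_finrank_eq (M := M) (k := k)
      (Cardinal.natCast_le_aleph0.trans (not_lt.1 fun hlt => hinf (Module.rank_lt_aleph0_iff.1 hlt)))
    exact ⟨K, hK.trans hM, hfd, hfr, fun p hp => hle p (hK hp)⟩
  · obtain ⟨K, hK, hfd, hfr, h0⟩ := exists_graph_subspace_of_le_kernelDim h
    refine ⟨K, hK, hfd, hfr, fun p hp => ?_⟩
    rw [h0 p hp, norm_zero]
    positivity

variable {A : X →ₗ.[𝕜] Y} {ε : ℝ}

theorem eventually_isLowerSemiFredholm_of_opSSAdjustment_lt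
    (hε : ∀ (S : Set ℕ) (L : ℕ → Submodule 𝕜 (X × Y)),
      (∀ N : ℕ, ∃ᶠ n in along S, (N : Cardinal) ≤ Module.rank 𝕜 (L n)) →
      (∀ δ : ℝ, 0 < δ → ∀ᶠ n in along S, ∀ p ∈ L n, ‖p.2‖ ≤ δ * ‖p‖) →
      ε ≤ adjustment S L (fun _ => A.graph))
    {S : Set ℕ} {B : ℕ → X →ₗ.[𝕜] Y} (hB : ∀ n ∈ S, (B n).IsClosed)
    (h : opSSAdjustment S B (fun _ => A) < ε) :
    ∀ᶠ n in along S, IsLowerSemiFredholm (B n) := by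
  by_contra hn
  have hinf : {n | n ∈ S ∧ ¬ IsLowerSemiFredholm (B n)}.Infinite :=
    Nat.frequently_atTop_iff_infinite.1 (frequently_along.1 (not_eventually.1 hn))
  obtain ⟨l, hl, hadj⟩ := exists_lowerSSAdjusted_of_ssAdjustment_lt h
  have hK : ∀ n, ∃ K : Submodule 𝕜 (X × Y), n ∈ {n | n ∈ S ∧ ¬ IsLowerSemiFredholm (B n)} →
      (K ≤ (B n).graph ∧ IsClosed (K : Set (X × Y)) ∧ ¬ FiniteDimensional 𝕜 K) ∧
        -- The bound tends to `0` with `n` and is inherited by every `L n ≤ K n`.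
        ∀ p ∈ K, ‖p.2‖ ≤ 1 / ((n : ℝ) + 1) * ‖p‖ := by
    intro n
    by_cases hn : n ∈ {n | n ∈ S ∧ ¬ IsLowerSemiFredholm (B n)}
    · obtain ⟨K, hK⟩ := exists_graph_subspace_of_not_isLowerSemiFredholm (hB n hn.1) hn.2
        (δ := 1 / ((n : ℝ) + 1)) (by positivity)
      exact ⟨K, fun _ => hK⟩
    · exact ⟨⊥, fun h => absurd h hn⟩
  choose K hK using hK
  obtain ⟨S₂, hS₂, hS₂inf, L, hL, hle⟩ :=
    hadj _ (fun n hn => hn.1) hinf K fun n hn => (hK n hn).1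
  have := along_neBot hS₂inf
  refine absurd (hε S₂ L (fun N => Eventually.frequently ?_) fun δ hδ => ?_)
    (not_le.2 (hle.trans_lt hl))
  · refine eventually_along.2 (Eventually.of_forall fun n hn => ?_)
    exact Cardinal.natCast_le_aleph0.trans
      (not_lt.1 fun hlt => (hL n hn).2.2 (Module.rank_lt_aleph0_iff.1 hlt))
  · refine eventually_along.2 ?_
    filter_upwards [(tendsto_one_div_add_atTop_nhds_zero_nat (𝕜 := ℝ)).eventually_le_const hδ]
      with n hnδ hn p hp
    exact ((hK n (hS₂ hn)).2 p ((hL n hn).1 hp)).trans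
      (mul_le_mul_of_nonneg_right hnδ (norm_nonneg _))

theorem le_opFSSAdjustment
    (hε : ∀ (S : Set ℕ) (L : ℕ → Submodule 𝕜 (X × Y)),
      (∀ N : ℕ, ∃ᶠ n in along S, (N : Cardinal) ≤ Module.rank 𝕜 (L n)) →
      (∀ δ : ℝ, 0 < δ → ∀ᶠ n in along S, ∀ p ∈ L n, ‖p.2‖ ≤ δ * ‖p‖) →
      ε ≤ adjustment S L (fun _ => A.graph))
    {S : Set ℕ} {B : ℕ → X →ₗ.[𝕜] Y} (hB : ∀ n ∈ S, (B n).IsClosed)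
    (h : ∀ k : ℕ, ∃ᶠ n in along S, ¬ IsLowerSemiFredholm (B n) ∨ (k : ℕ∞) ≤ kernelDim (B n)) :
    ε ≤ opFSSAdjustment S B (fun _ => A) := by
  by_contra! hlt
  obtain ⟨l, hl, hadj⟩ := exists_lowerFSSAdjusted_of_fssAdjustment_lt hlt
  -- The `k`-th chosen index carries a `k`-dimensional subspace with bound `1 / (k + 1)`, so
  -- dimension and smallness improve together.
  obtain ⟨φ, hφ, hφS⟩ := extraction_forall_of_frequently fun k => frequently_along.1 (h k)
  have hK := fun k => exists_graph_subspace_finrank_eq (hB _ (hφS k).1) (hφS k).2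
    (δ := 1 / ((k : ℝ) + 1)) (by positivity)
  choose K hKle hKfd hKfr hK using hK
  obtain ⟨S₂, hS₂, hS₂inf, L, hL, hLtop, hle⟩ := hadj (Set.range φ)
    (by rintro _ ⟨k, rfl⟩; exact (hφS k).1) (Set.infinite_range_of_injective hφ.injective)
    (Function.extend φ K ⊥)
    (by
      rintro _ ⟨k, rfl⟩
      rw [hφ.injective.extend_apply]
      exact ⟨hKle k, hKfd k⟩)
    (by
      rw [along_range hφ, tendsto_map'_iff]
      refine tendsto_id.congr fun k => ?_
      simp only [Function.comp_apply, id]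
      rw [hφ.injective.extend_apply, hKfr])
  have := along_neBot hS₂inf
  refine absurd (hε S₂ L (fun N => Eventually.frequently ?_) fun δ hδ => ?_)
    (not_le.2 (hle.trans_lt hl))
  · filter_upwards [hLtop.eventually_ge_atTop N] with n hn
    exact (Nat.cast_le.2 hn).trans (Cardinal.natCast_toNat_le _)
  · have hle : along S₂ ≤ along (Set.range φ) := inf_le_inf_left _ (principal_mono.2 hS₂)
    have hmap : ∀ᶠ n in along (Set.range φ), ∀ p ∈ Function.extend φ K ⊥ n, ‖p.2‖ ≤ δ * ‖p‖ := by
      rw [along_range hφ, eventually_map]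
      filter_upwards [(tendsto_one_div_add_atTop_nhds_zero_nat (𝕜 := ℝ)).eventually_le_const hδ]
        with k hk p hp
      rw [hφ.injective.extend_apply] at hp
      exact (hK k p hp).trans (mul_le_mul_of_nonneg_right hk (norm_nonneg _))
    filter_upwards [hle hmap, eventually_along.2 (Eventually.of_forall hL)] with n hn hLn p hp
    exact hn p (hLn hp)

end Operators

end UniformAdjustment

theorem theorem4p2p3 {𝕜 : Type*} [RCLike 𝕜] {X Y : Type*}
    [NormedAddCommGroup X] [NormedSpace 𝕜 X] [CompleteSpace X]
    [NormedAddCommGroup Y] [NormedSpace 𝕜 Y] [CompleteSpace Y]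
    (A : X →ₗ.[𝕜] Y) (hA : UniformAdjustment.IsLowerSemiFredholm A) :
    ∃ ε : ℝ, 0 < ε ∧
      ∀ (S : Set ℕ), S.Infinite →
        ∀ (B : ℕ → X →ₗ.[𝕜] Y), (∀ n ∈ S, (B n).IsClosed) →
          (UniformAdjustment.opFSSAdjustment S B (fun _ => A) < ε →
            (∀ᶠ n in UniformAdjustment.along S, UniformAdjustment.IsLowerSemiFredholm (B n)) ∧
            limsup (fun n => UniformAdjustment.kernelDim (B n)) (UniformAdjustment.along S) < ⊤) ∧
          (UniformAdjustment.opSSAdjustment S B (fun _ => A) < ε →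
            ∀ᶠ n in UniformAdjustment.along S, UniformAdjustment.IsLowerSemiFredholm (B n)) := by
  obtain ⟨ε, hε0, hε⟩ := UniformAdjustment.exists_le_adjustment hA
  refine ⟨ε, hε0, fun S _ B hB => ⟨fun h => ⟨?_, ?_⟩,
    UniformAdjustment.eventually_isLowerSemiFredholm_of_opSSAdjustment_lt hε hB⟩⟩
  · by_contra hn
    exact absurd (UniformAdjustment.le_opFSSAdjustment hε hB fun k =>
      (not_eventually.1 hn).mono fun _ => Or.inl) (not_le.2 h)
  · by_contra hn
    refine absurd (UniformAdjustment.le_opFSSAdjustment hε hB fun k => ?_) (not_le.2 h)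
    -- If the frequent bound `k ≤ kernelDim (B n)` failed for some `k`, the upper limit would be at
    -- most that `k`.
    by_contra hk
    refine hn (lt_of_le_of_lt (limsup_le_of_le (by isBoundedDefault) ?_) (ENat.natCast_lt_top k))
    filter_upwards [not_frequently.1 hk] with n hn
    exact (not_le.1 (not_or.1 hn).2).le
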